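/- Let $X$ be a real Hilbert space, let $m\ge 2$ be an integer and, for $i=1,\dots,m$, let $\alpha_i>0$ and let $A_i:X\to X$ be $\alpha_i$-cocoercive, i.e. $\alpha_iA_i$ is firmly nonexpansive ($F$ is firmly nonexpansive if $\|Fx-Fy\|^2+\|(x-Fx)-(y-Fy)\|^2\le\|x-y\|^2$ for all $x,y$). In the Hilbert product space $X^m$ set $\boldsymbol\Delta=\{(x,\dots,x): x\in X\}$, $\alpha=\min_i\alpha_i$, $\mathbf A(x_1,\dots,x_m)=(\alpha A_1x_1,\dots,\alpha A_mx_m)$, $\mathbf B=N_{\boldsymbol\Delta}$ (the normal cone operator), and let $\mathbf T=J_{\mathbf B}(\mathrm{Id}-\mathbf A)$, where $J_{\mathbf B}=(\mathrm{Id}+\mathbf B)^{-1}$, be the forward-backward operator. Suppose that the minimal displacement vector $\mathbf v:=P_{\overline{\operatorname{ran}}(\mathrm{Id}-\mathbf T)}0$ belongs to $\operatorname{ran}(\mathrm{Id}-\mathbf T)$, let $\mathbf x\in X^m$, and let $\mathbf Z_{\mathbf v}=\{\mathbf z\in X^m: 0\in -\mathbf v+\mathbf A\mathbf z+\mathbf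 B(\mathbf z-\mathbf v)\}$. Then: (i) $\boldsymbol\Delta^\perp=\{(u_1,\dots,u_m)\in X^m:\sum_{i=1}^m u_i=0\}$. (ii) $\mathbf Z_{\mathbf v}=(\mathbf v+\boldsymbol\Delta)\cap\mathbf A^{-1}(\mathbf v+\boldsymbol\Delta^\perp)$. (iii) $\mathbf v=0$ if and only if there is $z\in X$ with $\sum_{i=1}^mA_iz=0$. (iv) If $X$ is finite-dimensional, then $\operatorname{ran}(\mathrm{Id}-\mathbf T)\simeq\boldsymbol\Delta^\perp+\alpha\,(\operatorname{ran}A_1\times\cdots\times\operatorname{ran}A_m)$, where $C\simeq D$ means that $C$ and $D$ have the same closure and the same relative interior. If, moreover, every $A_i$ is affine, then: (v) for every $n\in\mathbb N$, $(\mathbf v+\mathbf T)^n\mathbf x=(\mathbf T_{-\mathbf v})^n\mathbf x=\mathbf T^n\mathbf x+n\mathbf v$, where $\mathbf v+\mathbf T:\mathbf y\mapsto\mathbf v+\mathbf T\mathbf y$ and $\mathbf T_{-\mathbf v}:\mathbf y\mapsto\mathbf T(\mathbf y+\mathbf v)$; the sets $\operatorname{Fix}(\mathbf v+\mathbf T)$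 and $\mathbf Z_{\mathbf v}$ are nonempty, closed and convex; and, as $n\to\infty$, this sequence converges in norm to $P_{\operatorname{Fix}(\mathbf v+\mathbf T)}\mathbf x=P_{\mathbf Z_{\mathbf v}}\mathbf x$. (vi) If $X$ is finite-dimensional, then $(\mathbf v+\mathbf T)^n\mathbf x\to P_{\operatorname{Fix}(\mathbf v+\mathbf T)}\mathbf x=P_{\mathbf Z_{\mathbf v}}\mathbf x$ linearly, i.e. there are $\mu\in(0,1)$ and $M\ge0$ with $\|(\mathbf v+\mathbf T)^n\mathbf x-P_{\mathbf Z_{\mathbf v}}\mathbf x\|\le M\mu^n$ for all $n\in\mathbb N$. (vii) If $X$ is finite-dimensional, then $\operatorname{ran}(\mathrm{Id}-\mathbf T)=\boldsymbol\Delta^\perp+\alpha\,(\operatorname{ran}A_1\times\cdots\times\operatorname{ran}A_m)$. -/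

import Mathlib

open Set Filter Topology
open scoped Pointwise InnerProductSpace

namespace FBSplit

section General

variable {E : Type*} [NormedAddCommGroup E] [InnerProductSpace ℝ E]

/-- `p` is a nearest point of `C` to `x`. -/
def IsNearest (C : Set E) (x p : E) : Prop :=
  p ∈ C ∧ ∀ c ∈ C, ‖x - p‖ ≤ ‖x - c‖

open Classical in
/-- The projector `P_C`: the nearest point of `C` to `x` (unique when `C` is nonempty, closed and
convex, see `isNearest_metricProj` and `metricProj_eq`). -/
noncomputable def metricProj (C : Set E) (x : E) : E :=
  if h : ∃ p, IsNearest C x p then h.choose else 0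

/-- Nonempty, closed and convex sets. -/
def IsNonemptyClosedConvex (C : Set E) : Prop :=
  C.Nonempty ∧ IsClosed C ∧ Convex ℝ C

/-- Firm nonexpansiveness. -/
def FirmlyNonexpansive (T : E → E) : Prop :=
  ∀ x y, ‖T x - T y‖ ^ 2 + ‖(x - T x) - (y - T y)‖ ^ 2 ≤ ‖x - y‖ ^ 2

/-- `A` is `α`-cocoercive (used with `0 < α`): `α A` is firmly nonexpansive. -/
def Cocoercive (α : ℝ) (A : E → E) : Prop :=
  FirmlyNonexpansive (fun x => α • A x)

/-- A single-valued operator is affine. -/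
def IsAffineOp (A : E → E) : Prop := ∃ F : E →ᵃ[ℝ] E, ∀ x, F x = A x

/-- The normal cone operator `N_C`, a set-valued operator that is empty-valued outside `C`. -/
def normalCone (C : Set E) (x : E) : Set E :=
  {u | x ∈ C ∧ ∀ c ∈ C, ⟪u, c - x⟫_ℝ ≤ 0}

/-- Monotonicity of a set-valued operator. -/
def MonotoneOp (B : E → Set E) : Prop :=
  ∀ x y, ∀ u ∈ B x, ∀ w ∈ B y, 0 ≤ ⟪x - y, u - w⟫_ℝ

open Classical in
/-- The resolvent `J_B = (Id + B)⁻¹` of a set-valued operator: `J_B x` is the point `p` with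
`x ∈ p + B p`, which is unique when `B` is monotone (see `resolvent_eq`). -/
noncomputable def resolvent (B : E → Set E) (x : E) : E :=
  if h : ∃ p, x - p ∈ B p then h.choose else 0

/-- The forward-backward operator `J_B ∘ (Id - A)`. -/
noncomputable def forwardBackward (A : E → E) (B : E → Set E) (x : E) : E :=
  resolvent B (x - A x)

/-- The range of the displacement map `Id - T`. -/
def ranDisp (T : E → E) : Set E := range (fun x => x - T x)

/-- The minimal displacement vector: the projection of `0` onto the closure of `ran (Id - T)`. -/
noncomputable def minDisp (T : E → E) : E := metricProj (closure (ranDisp T)) 0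

/-- The inner shift `C_w x = C (x - w)`, for single-valued and set-valued operators alike. -/
def innerShift {F : Type*} (C : E → F) (w x : E) : F := C (x - w)

/-- The outer shift `x ↦ -w + A x`. -/
def outerShift (w : E) (A : E → E) (x : E) : E := -w + A x

/-- The zeros of `A + B`. -/
def sumZeros (A : E → E) (B : E → Set E) : Set E := {x | ∃ u ∈ B x, A x + u = 0}

/-- The solution set `Z_w` of the `w`-perturbed problem. -/
def perturbedZeros (A : E → E) (B : E → Set E) (w : E) : Set E :=
  sumZeros (outerShift w A) (innerShift B w)

/-- Near equality: the same closure and the same relative interior. -/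
def NearlyEqual (C D : Set E) : Prop :=
  closure C = closure D ∧ intrinsicInterior ℝ C = intrinsicInterior ℝ D

/-- The sequence `y` converges to `p` linearly. -/
def ConvergesLinearly (y : ℕ → E) (p : E) : Prop :=
  ∃ μ : ℝ, 0 < μ ∧ μ < 1 ∧ ∃ M : ℝ, ∀ n, ‖y n - p‖ ≤ M * μ ^ n

theorem nearest_iff_inner {C : Set E} (hC : Convex ℝ C) {x p : E} (hp : p ∈ C) :
    IsNearest C x p ↔ ∀ c ∈ C, ⟪x - p, c - p⟫_ℝ ≤ 0 := by
  rw [← norm_eq_iInf_iff_real_inner_le_zero hC hp]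
  have : Nonempty C := ⟨⟨p, hp⟩⟩
  have hb : BddBelow (range fun w : C => ‖x - w‖) := ⟨0, by rintro _ ⟨w, rfl⟩; positivity⟩
  constructor
  · intro h
    exact le_antisymm (le_ciInf fun w => h.2 w w.2) (ciInf_le hb ⟨p, hp⟩)
  · intro h
    exact ⟨hp, fun c hc => h ▸ ciInf_le hb ⟨c, hc⟩⟩

theorem nearest_unique {C : Set E} (hC : Convex ℝ C) {x p q : E}
    (hp : IsNearest C x p) (hq : IsNearest C x q) : p = q := by
  have h1 := (nearest_iff_inner hC hp.1).1 hp q hq.1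
  have h2 := (nearest_iff_inner hC hq.1).1 hq p hp.1
  have h3 : ⟪p - q, p - q⟫_ℝ ≤ 0 := by
    have : ⟪p - q, p - q⟫_ℝ = ⟪x - p, q - p⟫_ℝ + ⟪x - q, p - q⟫_ℝ := by
      simp only [inner_sub_left, inner_sub_right]; ring
    linarith
  exact sub_eq_zero.1 (real_inner_self_nonpos.1 h3)

theorem isNearest_metricProj [CompleteSpace E] {C : Set E} (hC : IsNonemptyClosedConvex C)
    (x : E) : IsNearest C x (metricProj C x) := by
  have h : ∃ p, IsNearest C x p := by
    obtain ⟨p, hp, hpx⟩ :=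
      exists_norm_eq_iInf_of_complete_convex hC.1 hC.2.1.isComplete hC.2.2 x
    exact ⟨p, (nearest_iff_inner hC.2.2 hp).2
      ((norm_eq_iInf_iff_real_inner_le_zero hC.2.2 hp).1 hpx)⟩
  rw [metricProj, dif_pos h]
  exact h.choose_spec

theorem metricProj_eq {C : Set E} (hC : Convex ℝ C) {x p : E} (hp : IsNearest C x p) :
    metricProj C x = p := by
  have h : ∃ p, IsNearest C x p := ⟨p, hp⟩
  rw [metricProj, dif_pos h]
  exact nearest_unique hC h.choose_spec hp

theorem resolvent_eq {B : E → Set E} (hB : MonotoneOp B) {x p : E} (hp : x - p ∈ B p) :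
    resolvent B x = p := by
  have h : ∃ p, x - p ∈ B p := ⟨p, hp⟩
  rw [resolvent, dif_pos h]
  have h1 := hB _ _ _ h.choose_spec _ hp
  have h2 : (x - h.choose) - (x - p) = -(h.choose - p) := by abel
  rw [h2, inner_neg_right] at h1
  exact sub_eq_zero.1 (real_inner_self_nonpos.1 (by linarith : ⟪h.choose - p, h.choose - p⟫_ℝ ≤ 0))

theorem monotoneOp_normalCone (C : Set E) : MonotoneOp (normalCone C) := by
  intro x y u hu w hw
  have h1 := hu.2 y hw.1
  have h2 := hw.2 x hu.1
  have : ⟪x - y, u - w⟫_ℝ = -⟪u, y - x⟫_ℝ - ⟪w, x - y⟫_ℝ := by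
    rw [real_inner_comm]; simp only [inner_sub_left, inner_sub_right]; ring
  linarith

theorem resolvent_normalCone [CompleteSpace E] {C : Set E} (hC : IsNonemptyClosedConvex C)
    (x : E) : resolvent (normalCone C) x = metricProj C x := by
  have h := isNearest_metricProj hC x
  exact resolvent_eq (monotoneOp_normalCone C) ⟨h.1, (nearest_iff_inner hC.2.2 h.1).1 h⟩

end General

section ProductSpace

variable {X : Type*} [NormedAddCommGroup X] [InnerProductSpace ℝ X]

/-- The Hilbert product space `X^m`, with inner product `∑ i, ⟪x i, y i⟫`. -/
abbrev ProdSpace (m : ℕ) (X : Type*) : Type _ := PiLp 2 (fun _ : Fin m => X)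

/-- The diagonal of `X^m`. -/
def diagonal (m : ℕ) (X : Type*) [NormedAddCommGroup X] [InnerProductSpace ℝ X] :
    Submodule ℝ (ProdSpace m X) where
  carrier := {x | ∃ z : X, ∀ i, x i = z}
  add_mem' := by
    rintro x y ⟨z, hz⟩ ⟨w, hw⟩
    exact ⟨z + w, fun i => by simp [hz, hw]⟩
  zero_mem' := ⟨0, fun i => by simp⟩
  smul_mem' := by
    rintro c x ⟨z, hz⟩
    exact ⟨c • z, fun i => by simp [hz]⟩

/-- The product operator `(x_1, …, x_m) ↦ (α A_1 x_1, …, α A_m x_m)`. -/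
def scaledProdOp {m : ℕ} (α : ℝ) (A : Fin m → X → X) (x : ProdSpace m X) : ProdSpace m X :=
  WithLp.toLp 2 (fun i => α • A i (x i))

/-- The product of sets `S_1 × … × S_m` in `X^m`. -/
def prodSet {m : ℕ} (S : Fin m → Set X) : Set (ProdSpace m X) := {u | ∀ i, u i ∈ S i}

/-- The parallel-splitting operator: forward-backward for the product operator and the normal
cone of the diagonal. -/
noncomputable def parallelFB {m : ℕ} (α : ℝ) (A : Fin m → X → X) : ProdSpace m X → ProdSpace m X :=
  forwardBackward (scaledProdOp α A) (normalCone (diagonal m X : Set (ProdSpace m X)))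

/-- The set of normal solutions `Z_v` of the product-space problem. -/
noncomputable def normalSolutions {m : ℕ} (α : ℝ) (A : Fin m → X → X) : Set (ProdSpace m X) :=
  perturbedZeros (scaledProdOp α A) (normalCone (diagonal m X : Set (ProdSpace m X)))
    (minDisp (parallelFB α A))

end ProductSpace

end FBSplit

namespace FBSplit

/-! ### Projected steps `projStep K A` on a closed subspace, averagedness and rectangularity -/

section Operators

variable {E : Type*} [NormedAddCommGroup E] [InnerProductSpace ℝ E]

/-! The normal cone of a subspace `K` has resolvent `P_K`, so the operator is `T = P_K (Id - A)`
with `A` firmly nonexpansive, and `y - T y = P_{Kᗮ} y + P_K A y` lies in `D = Kᗮ + ran A`.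

Near equality: `⟪(y - T y) - z, y⟫` is bounded below in `y` for every `z ∈ D`
(`exists_le_inner_sub_projStep`). Solving `ε y + (y - T y) = z` and letting `ε → 0` shows that `z`
is in the closure of the range. If `z` is a relative interior point of `D` and the dimension is
finite, Banach-Steinhaus bounds the solutions, and a cluster point solves `y - T y = z`.

Affine case: the linear part `L` of `T` is averaged, so `Fix L` is the orthogonal complement of `ran
(Id - L)`, and `L ^ n → 0` strongly on the closure of that range. Minimality makes `v` orthogonal to
`ran (Id - L)`, hence `L v = v`; both shifts then agree and the iterates differ from those of `T` by
`n • v`. Splitting `x` minus a fixed point along the two orthogonal subspaces writes the iterates of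
`v + T` as the projection of `x` plus `L ^ n r` (`exists_limit_decomposition`). In finite dimension
`L` contracts strictly on `ran (Id - L)`, which gives the rate. -/

theorem firmlyNonexpansive_iff {F : E → E} :
    FirmlyNonexpansive F ↔ ∀ x y, ‖F x - F y‖ ^ 2 ≤ ⟪x - y, F x - F y⟫_ℝ := by
  refine forall₂_congr fun x y => ?_
  rw [sub_sub_sub_comm, norm_sub_sq_real (x - y)]
  constructor <;> intro h <;> linarith

theorem FirmlyNonexpansive.smul {F : E → E} (hF : FirmlyNonexpansive F) {t : ℝ} (ht0 : 0 ≤ t)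
    (ht1 : t ≤ 1) : FirmlyNonexpansive (fun x => t • F x) := by
  rw [firmlyNonexpansive_iff] at hF ⊢
  intro x y
  rw [← smul_sub, norm_smul, inner_smul_right, mul_pow, Real.norm_of_nonneg ht0]
  calc t ^ 2 * ‖F x - F y‖ ^ 2 ≤ t * ‖F x - F y‖ ^ 2 := by
        gcongr; nlinarith
    _ ≤ _ := mul_le_mul_of_nonneg_left (hF x y) ht0

theorem Cocoercive.anti {a b : ℝ} {A : E → E} (hA : Cocoercive a A) (hb : 0 < b) (hba : b ≤ a) :
    Cocoercive b A := by
  have ha : 0 < a := hb.trans_le hba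
  have h := FirmlyNonexpansive.smul hA (t := b / a) (by positivity) ((div_le_one ha).2 hba)
  simpa only [Cocoercive, smul_smul, div_mul_cancel₀ _ ha.ne'] using h

/-- The projected step `y ↦ P_K (y - A y)`. -/
noncomputable def projStep (K : Submodule ℝ E) [K.HasOrthogonalProjection] (A : E → E) (y : E) :
    E := K.starProjection (y - A y)

variable (K : Submodule ℝ E) [K.HasOrthogonalProjection]

omit [K.HasOrthogonalProjection] in
theorem mem_normalCone_submodule {x u : E} : u ∈ normalCone (K : Set E) x ↔ x ∈ K ∧ u ∈ Kᗮ := by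
  refine and_congr_right fun hx => ?_
  rw [Submodule.mem_orthogonal']
  constructor
  · intro h c hc
    have h1 := h (x + c) (K.add_mem hx hc)
    have h2 := h (x - c) (K.sub_mem hx hc)
    rw [add_sub_cancel_left] at h1
    rw [sub_sub_cancel_left, inner_neg_right] at h2
    linarith
  · intro h c hc
    exact (h _ (K.sub_mem hc hx)).le

theorem forwardBackward_normalCone (A : E → E) :
    forwardBackward A (normalCone (K : Set E)) = projStep K A := by
  funext x
  exact resolvent_eq (monotoneOp_normalCone _) ((mem_normalCone_submodule K).2
    ⟨K.starProjection_apply_mem _, K.sub_starProjection_mem_orthogonal _⟩)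

omit [K.HasOrthogonalProjection] in
theorem mem_perturbedZeros_iff {A : E → E} {v z : E} :
    z ∈ perturbedZeros A (normalCone (K : Set E)) v ↔ z - v ∈ K ∧ A z - v ∈ Kᗮ := by
  simp only [perturbedZeros, sumZeros, outerShift, innerShift, mem_ofPred_eq,
    mem_normalCone_submodule]
  constructor
  · rintro ⟨u, ⟨h1, h2⟩, h3⟩
    refine ⟨h1, ?_⟩
    rw [show A z - v = -u by rw [← sub_eq_zero, ← h3]; abel]
    exact Kᗮ.neg_mem h2
  · rintro ⟨h1, h2⟩
    exact ⟨-(A z - v), ⟨h1, Kᗮ.neg_mem h2⟩, by abel⟩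

/-- In `z - A z = (z - v) - (A z - v)` the two terms lie in `K` and `Kᗮ` exactly when `P_K` sends
the left side to `z - v`. -/
theorem perturbedZeros_eq_fixedPoints (A : E → E) (v : E) :
    perturbedZeros A (normalCone (K : Set E)) v
      = Function.fixedPoints (fun y => v + projStep K A y) := by
  ext z
  rw [mem_perturbedZeros_iff, Function.mem_fixedPoints, Function.IsFixedPt, projStep]
  have key : z - A z = (z - v) - (A z - v) := by abel
  constructor
  · rintro ⟨h1, h2⟩
    rw [key, map_sub, K.starProjection_eq_self_iff.2 h1,
      (K.starProjection_apply_eq_zero_iff).2 h2]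
    abel
  · intro h
    have h0 : z - v = K.starProjection (z - A z) := by
      nth_rewrite 1 [← h]; abel
    have h1 : z - v ∈ K := h0 ▸ K.starProjection_apply_mem _
    refine ⟨h1, ?_⟩
    rw [key, map_sub, K.starProjection_eq_self_iff.2 h1] at h0
    exact (K.starProjection_apply_eq_zero_iff).1 (sub_eq_self.1 h0.symm)

variable {K} in
-- Pythagoras splits the difference `n` of the forward steps; the displacement difference is `b`
-- plus the `Kᗮ` part of `n`. Bounding the square of that sum by twice the sum of squares produces
-- the factor `1 / 2`.
theorem FirmlyNonexpansive.projStep_averaged {A : E → E} (hA : FirmlyNonexpansive A) (x y : E) :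
    ‖projStep K A x - projStep K A y‖ ^ 2
      + 1 / 2 * ‖(x - projStep K A x) - (y - projStep K A y)‖ ^ 2 ≤ ‖x - y‖ ^ 2 := by
  set n := (x - A x) - (y - A y) with hn
  set b := A x - A y with hb
  have hT : projStep K A x - projStep K A y = K.starProjection n := by
    rw [projStep, projStep, ← map_sub]
  have hd : (x - projStep K A x) - (y - projStep K A y) = b + (n - K.starProjection n) := by
    rw [← hT, hn, hb]; abel
  have h1 : ‖b‖ ^ 2 + ‖n‖ ^ 2 ≤ ‖x - y‖ ^ 2 := hA x y
  have h2 : ‖n‖ ^ 2 = ‖K.starProjection n‖ ^ 2 + ‖n - K.starProjection n‖ ^ 2 := by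
    have := norm_add_sq_eq_norm_sq_add_norm_sq_of_inner_eq_zero (K.starProjection n)
      (n - K.starProjection n)
      (Submodule.inner_right_of_mem_orthogonal (K.starProjection_apply_mem _)
        (K.sub_starProjection_mem_orthogonal _))
    rw [add_sub_cancel] at this
    simpa only [pow_two] using this
  have h3 : ‖b + (n - K.starProjection n)‖ ^ 2 ≤ 2 * (‖b‖ ^ 2 + ‖n - K.starProjection n‖ ^ 2) := by
    have := parallelogram_law_with_norm ℝ b (n - K.starProjection n)
    nlinarith [sq_nonneg ‖b - (n - K.starProjection n)‖]
  rw [hT, hd]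
  linarith

theorem sub_projStep (A : E → E) (y : E) :
    y - projStep K A y = (y - K.starProjection y) + K.starProjection (A y) := by
  rw [projStep, map_sub]; abel

theorem ranDisp_projStep_subset (A : E → E) :
    ranDisp (projStep K A) ⊆ (Kᗮ : Set E) + range A := by
  rintro _ ⟨y, rfl⟩
  refine ⟨_, Kᗮ.sub_mem (K.sub_starProjection_mem_orthogonal y)
    (K.sub_starProjection_mem_orthogonal (A y)), _, ⟨y, rfl⟩, ?_⟩
  simp only [sub_projStep]
  abel

theorem mem_ranDisp_zero_iff (A : E → E) :
    (0 : E) ∈ ranDisp (projStep K A) ↔ ∃ y ∈ K, A y ∈ Kᗮ := by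
  constructor
  · rintro ⟨y, hy⟩
    have hy : y = projStep K A y := sub_eq_zero.1 hy
    have h1 : y ∈ K := by rw [hy]; exact K.starProjection_apply_mem _
    refine ⟨y, h1, ?_⟩
    rw [projStep, map_sub, K.starProjection_eq_self_iff.2 h1] at hy
    exact (K.starProjection_apply_eq_zero_iff).1 (sub_eq_self.1 hy.symm)
  · rintro ⟨y, h1, h2⟩
    refine ⟨y, ?_⟩
    simp only [sub_projStep]
    rw [K.starProjection_eq_self_iff.2 h1, (K.starProjection_apply_eq_zero_iff).2 h2]
    simp

variable {K} in
-- Write `Q` for the `Kᗮ` part of `y`. The `Kᗮ` component contributes `‖Q‖ ^ 2` up to a linear term,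
-- and cocoercivity contributes `‖A y - b‖ ^ 2`; together they absorb every cross term.
theorem FirmlyNonexpansive.exists_le_inner_sub_projStep {A : E → E} (hA : FirmlyNonexpansive A)
    {z : E} (hz : z ∈ (Kᗮ : Set E) + range A) :
    ∃ C : ℝ, ∀ y, -C ≤ ⟪(y - projStep K A y) - z, y⟫_ℝ := by
  obtain ⟨q, hq, _, ⟨w, rfl⟩, rfl⟩ := hz
  rw [firmlyNonexpansive_iff] at hA
  set b := A w
  set r := q + (b - K.starProjection b) with hr
  have hrK : r ∈ Kᗮ := Kᗮ.add_mem hq (K.sub_starProjection_mem_orthogonal b)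
  refine ⟨‖r‖ ^ 2 + ‖w‖ ^ 2, fun y => ?_⟩
  set Q := y - K.starProjection y with hQ
  have hQK : Q ∈ Kᗮ := K.sub_starProjection_mem_orthogonal y
  have e1 : (y - projStep K A y) - (q + b) = (Q - r) + K.starProjection (A y - b) := by
    rw [sub_projStep, hr, hQ, map_sub]; abel
  have e2 : y = K.starProjection y + Q := by rw [hQ]; abel
  have e3 : ⟪Q - r, y⟫_ℝ = ⟪Q - r, Q⟫_ℝ := by
    nth_rewrite 1 [e2]
    rw [inner_add_right, Submodule.inner_left_of_mem_orthogonal (K.starProjection_apply_mem y)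
      (Kᗮ.sub_mem hQK hrK), zero_add]
  have e4 : ⟪K.starProjection (A y - b), y⟫_ℝ = ⟪A y - b, y - w⟫_ℝ + ⟪A y - b, w - Q⟫_ℝ := by
    rw [K.inner_starProjection_left_eq_right, ← inner_add_right, hQ]
    congr 1; abel
  have h1 : ‖A y - b‖ ^ 2 ≤ ⟪A y - b, y - w⟫_ℝ := by
    rw [real_inner_comm]; exact hA y w
  have h2 : -(‖A y - b‖ * ‖w - Q‖) ≤ ⟪A y - b, w - Q⟫_ℝ :=
    (abs_le.1 (abs_real_inner_le_norm _ _)).1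
  have h3 : -(‖r‖ * ‖Q‖) ≤ -⟪r, Q⟫_ℝ := neg_le_neg (real_inner_le_norm _ _)
  have h4 := norm_sub_le w Q
  rw [e1, inner_add_left, e3, e4, inner_sub_left, real_inner_self_eq_norm_sq]
  have h5 : ‖w - Q‖ ^ 2 ≤ 2 * ‖w‖ ^ 2 + 2 * ‖Q‖ ^ 2 := by
    nlinarith [norm_nonneg (w - Q), sq_nonneg (‖w‖ - ‖Q‖)]
  -- Completing squares costs `‖w - Q‖ ^ 2 / 4`, at most `(‖w‖ ^ 2 + ‖Q‖ ^ 2) / 2`, and `‖r‖ ^ 2 +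
  -- ‖Q‖ ^ 2 / 4`; the available `‖Q‖ ^ 2` covers both `Q` terms.
  nlinarith [sq_nonneg (2 * ‖A y - b‖ - ‖w - Q‖), sq_nonneg (2 * ‖r‖ - ‖Q‖), sq_nonneg ‖w‖,
    sq_nonneg ‖r‖]

end Operators

/-! ### Near equality by vanishing regularization -/

section NearEquality

variable {E : Type*} [NormedAddCommGroup E] [InnerProductSpace ℝ E] [CompleteSpace E]

theorem exists_smul_add_sub_eq {T : E → E} (hT : LipschitzWith 1 T) {ε : ℝ} (hε : 0 < ε) (z : E) :
    ∃ y, ε • y + (y - T y) = z := by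
  have hε1 : (0 : ℝ) < 1 + ε := by positivity
  have hc : ContractingWith (Real.toNNReal (1 + ε)⁻¹) (fun y => (1 + ε)⁻¹ • (z + T y)) := by
    refine ⟨by rw [Real.toNNReal_lt_one]; exact inv_lt_one_of_one_lt₀ (by linarith), ?_⟩
    refine LipschitzWith.of_dist_le_mul fun x y => ?_
    have h := hT.dist_le_mul x y
    rw [dist_eq_norm, dist_eq_norm] at h ⊢
    rw [← smul_sub, add_sub_add_left_eq_sub, norm_smul, Real.norm_of_nonneg (by positivity)]
    rw [Real.coe_toNNReal _ (by positivity)]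
    rw [NNReal.coe_one, one_mul] at h
    gcongr
  have h := hc.fixedPoint_isFixedPt
  set y := hc.fixedPoint
  refine ⟨y, ?_⟩
  have h' : (1 + ε)⁻¹ • (z + T y) = y := h
  rw [inv_smul_eq_iff₀ hε1.ne'] at h'
  rw [add_smul, one_smul] at h'
  rw [eq_sub_of_add_eq h']; abel

variable {T : E → E} {D : Set E}

/-- At a regularized solution, `(y - T y) - z = -ε y`, so the lower bound reads `ε ‖y‖ ^ 2 ≤ C`, and
`‖ε y‖ ^ 2 ≤ ε C` tends to `0`. -/
theorem exists_regularized_seq (hT : LipschitzWith 1 T) {z : E} {C : ℝ}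
    (hC : ∀ y, -C ≤ ⟪(y - T y) - z, y⟫_ℝ) :
    ∃ (ε : ℕ → ℝ) (y : ℕ → E), (∀ n, 0 < ε n) ∧ (∀ n, ε n • y n + (y n - T (y n)) = z) ∧
      Tendsto (fun n => y n - T (y n)) atTop (𝓝 z) := by
  have hpos : ∀ n : ℕ, 0 < 1 / ((n : ℝ) + 1) := fun n => Nat.one_div_pos_of_nat
  choose y hy using fun n : ℕ => exists_smul_add_sub_eq hT (hpos n) z
  refine ⟨_, y, hpos, hy, ?_⟩
  have hb : ∀ n : ℕ, ‖(1 / ((n : ℝ) + 1)) • y n‖ ^ 2 ≤ 1 / ((n : ℝ) + 1) * C := by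
    intro n
    have h1 := hC (y n)
    have h2 : (y n - T (y n)) - z = -((1 / ((n : ℝ) + 1)) • y n) := by
      rw [eq_sub_of_add_eq (hy n)]; abel
    rw [h2, inner_neg_left, inner_smul_left, real_inner_self_eq_norm_sq] at h1
    rw [norm_smul, mul_pow, Real.norm_of_nonneg (hpos n).le, sq (1 / ((n : ℝ) + 1)), mul_assoc]
    exact mul_le_mul_of_nonneg_left (by simpa using h1) (hpos n).le
  have hlim : Tendsto (fun n : ℕ => ‖(1 / ((n : ℝ) + 1)) • y n‖ ^ 2) atTop (𝓝 0) :=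
    squeeze_zero (fun n => by positivity) hb
      (by simpa using tendsto_one_div_add_atTop_nhds_zero_nat.mul_const C)
  have hlim' : Tendsto (fun n : ℕ => (1 / ((n : ℝ) + 1)) • y n) atTop (𝓝 0) := by
    rw [tendsto_zero_iff_norm_tendsto_zero]
    simpa [Real.sqrt_sq (norm_nonneg _)] using hlim.sqrt
  have := tendsto_const_nhds (x := z) |>.sub hlim'
  rw [sub_zero] at this
  exact this.congr fun n => by nth_rewrite 1 [← hy n]; abel

theorem subset_closure_ranDisp (hT : LipschitzWith 1 T)
    (hD : ∀ z ∈ D, ∃ C : ℝ, ∀ y, -C ≤ ⟪(y - T y) - z, y⟫_ℝ) : D ⊆ closure (ranDisp T) := by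
  intro z hz
  obtain ⟨C, hC⟩ := hD z hz
  obtain ⟨-, y, -, -, hy⟩ := exists_regularized_seq hT hC
  exact mem_closure_of_tendsto hy (Eventually.of_forall fun n => ⟨y n, rfl⟩)

omit [CompleteSpace E] in
theorem mem_intrinsicInterior_iff {s : Set E} {z : E} :
    z ∈ intrinsicInterior ℝ s ↔ z ∈ affineSpan ℝ s ∧
      ∃ δ > 0, ∀ w ∈ affineSpan ℝ s, dist w z < δ → w ∈ s := by
  rw [mem_intrinsicInterior]
  constructor
  · rintro ⟨⟨w, hw⟩, hw1, rfl⟩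
    obtain ⟨δ, hδ, h⟩ := Metric.mem_nhds_iff.1 (mem_interior_iff_mem_nhds.1 hw1)
    exact ⟨hw, δ, hδ, fun u hu hd => h (show (⟨u, hu⟩ : affineSpan ℝ s) ∈ Metric.ball _ δ from hd)⟩
  · rintro ⟨hz, δ, hδ, h⟩
    exact ⟨⟨z, hz⟩, mem_interior_iff_mem_nhds.2
      (Metric.mem_nhds_iff.2 ⟨δ, hδ, fun u hu => h u u.2 hu⟩), rfl⟩

/-- The regularized solutions lie in the direction space `V` of `D`. For `u ∈ V` a small `z + t u`
is still in `D`, and its own lower bound controls `⟪u, y n⟫` from above. -/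
theorem intrinsicInterior_subset_ranDisp [FiniteDimensional ℝ E] (hT : LipschitzWith 1 T)
    (hsub : ranDisp T ⊆ D)
    (hD : ∀ z ∈ D, ∃ C : ℝ, ∀ y, -C ≤ ⟪(y - T y) - z, y⟫_ℝ) :
    intrinsicInterior ℝ D ⊆ ranDisp T := by
  intro z hz
  have hzD := intrinsicInterior_subset hz
  obtain ⟨C, hC⟩ := hD z hzD
  obtain ⟨ε, y, hε, hy, hlim⟩ := exists_regularized_seq hT hC
  obtain ⟨hzA, δ, hδ, hball⟩ := mem_intrinsicInterior_iff.1 hz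
  set V := (affineSpan ℝ D).direction
  have hyV : ∀ n, y n ∈ V := by
    intro n
    have h1 : z - (y n - T (y n)) ∈ V :=
      AffineSubspace.vsub_mem_direction (subset_affineSpan ℝ D hzD)
        (subset_affineSpan ℝ D (hsub ⟨y n, rfl⟩))
    have h2 : ε n • y n = z - (y n - T (y n)) := eq_sub_of_add_eq (hy n)
    exact (V.smul_mem_iff (hε n).ne').1 (h2 ▸ h1)
  have hub : ∀ u : V, ∃ C, ∀ n, ⟪(u : E), y n⟫_ℝ ≤ C := by
    intro u
    -- The `+ 1` keeps the quotient meaningful at `u = 0`.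
    set t : ℝ := δ / (2 * (‖(u : E)‖ + 1)) with ht
    have htpos : 0 < t := by positivity
    have hsmall : ‖t • (u : E)‖ < δ := by
      rw [norm_smul, Real.norm_of_nonneg htpos.le, ht, div_mul_eq_mul_div, div_lt_iff₀ (by positivity)]
      nlinarith [norm_nonneg (u : E)]
    obtain ⟨C', hC'⟩ := hD (z + t • (u : E)) (hball _ (by
      rw [add_comm]; exact AffineSubspace.vadd_mem_of_mem_direction (V.smul_mem t u.2) hzA)
      (by simpa [dist_eq_norm] using hsmall))
    refine ⟨C' / t, fun n => ?_⟩
    have h1 := hC' (y n)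
    have h2 : (y n - T (y n)) - (z + t • (u : E)) = -(ε n • y n) - t • (u : E) := by
      rw [eq_sub_of_add_eq (hy n)]; abel
    rw [h2, inner_sub_left, inner_neg_left, inner_smul_left, inner_smul_left,
      real_inner_self_eq_norm_sq] at h1
    simp only [conj_trivial] at h1
    rw [le_div_iff₀ htpos]
    nlinarith [mul_nonneg (hε n).le (sq_nonneg ‖y n‖)]
  obtain ⟨M, hM⟩ := banach_steinhaus (g := fun n => innerSL ℝ (⟨y n, hyV n⟩ : V)) (by
    intro u
    obtain ⟨C1, h1⟩ := hub u
    obtain ⟨C2, h2⟩ := hub (-u)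
    refine ⟨max C1 C2, fun n => ?_⟩
    have h1 := h1 n
    have h2 := h2 n
    rw [Submodule.coe_neg, inner_neg_left] at h2
    rw [innerSL_apply_apply, Submodule.coe_inner, real_inner_comm, Real.norm_eq_abs, abs_le']
    exact ⟨h1.trans (le_max_left _ _), h2.trans (le_max_right _ _)⟩)
  have hbdd : ∀ n, y n ∈ Metric.closedBall (0 : E) M := by
    intro n
    have := hM n
    rw [innerSL_apply_norm] at this
    simpa using this
  obtain ⟨w, -, φ, hφ, hw⟩ := tendsto_subseq_of_bounded Metric.isBounded_closedBall hbdd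
  refine ⟨w, tendsto_nhds_unique ?_ (hlim.comp hφ.tendsto_atTop)⟩
  exact hw.sub ((hT.continuous.tendsto w).comp hw)

omit [CompleteSpace E] in
theorem affineSpan_closure_eq [FiniteDimensional ℝ E] (s : Set E) :
    affineSpan ℝ (closure s) = affineSpan ℝ s := by
  refine le_antisymm (affineSpan_le.2 ?_) (affineSpan_mono ℝ subset_closure)
  exact closure_minimal (subset_affineSpan ℝ s) (AffineSubspace.closed_of_finiteDimensional _)

/-- Range of a nonexpansive displacement map versus a set `D` on which it is rectangular. -/
theorem nearlyEqual_ranDisp [FiniteDimensional ℝ E] (hT : LipschitzWith 1 T)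
    (hsub : ranDisp T ⊆ D)
    (hD : ∀ z ∈ D, ∃ C : ℝ, ∀ y, -C ≤ ⟪(y - T y) - z, y⟫_ℝ) : NearlyEqual (ranDisp T) D := by
  have hcl : closure (ranDisp T) = closure D :=
    (closure_mono hsub).antisymm (closure_minimal (subset_closure_ranDisp hT hD) isClosed_closure)
  have hspan : affineSpan ℝ (ranDisp T) = affineSpan ℝ D := by
    rw [← affineSpan_closure_eq, hcl, affineSpan_closure_eq]
  refine ⟨hcl, Subset.antisymm ?_ ?_⟩
  · intro z hz
    rw [mem_intrinsicInterior_iff, hspan] at hz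
    rw [mem_intrinsicInterior_iff]
    obtain ⟨h1, δ, hδ, h⟩ := hz
    exact ⟨h1, δ, hδ, fun w hw hd => hsub (h w hw hd)⟩
  · intro z hz
    rw [mem_intrinsicInterior_iff] at hz
    rw [mem_intrinsicInterior_iff, hspan]
    obtain ⟨h1, δ, hδ, h⟩ := hz
    -- The relative interior is relatively open, so points of the span near `z` are themselves
    -- relative interior points of `D`.
    refine ⟨h1, δ, hδ, fun w hw hd => intrinsicInterior_subset_ranDisp hT hsub hD ?_⟩
    rw [mem_intrinsicInterior_iff]
    refine ⟨hw, δ - dist w z, sub_pos.2 hd, fun u hu hud => h u hu ?_⟩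
    linarith [dist_triangle u w z]

end NearEquality

/-! ### Powers of averaged linear maps -/

section LinearIterates

variable {E : Type*} [NormedAddCommGroup E] [InnerProductSpace ℝ E]

/-- A linear map which is `2/3`-averaged. -/
def AveragedLinear (L : E →L[ℝ] E) : Prop :=
  ∀ h, ‖L h‖ ^ 2 + 1 / 2 * ‖h - L h‖ ^ 2 ≤ ‖h‖ ^ 2

variable {L : E →L[ℝ] E}

theorem AveragedLinear.norm_apply_le (hL : AveragedLinear L) (h : E) : ‖L h‖ ≤ ‖h‖ :=
  pow_le_pow_iff_left₀ (norm_nonneg _) (norm_nonneg _) two_ne_zero |>.1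
    (by nlinarith [hL h, sq_nonneg ‖h - L h‖])

theorem AveragedLinear.norm_pow_apply_le (hL : AveragedLinear L) (n : ℕ) (h : E) :
    ‖(L ^ n) h‖ ≤ ‖h‖ := by
  induction n with
  | zero => simp
  | succ n ih => rw [pow_succ', mul_apply_eq_comp]; exact (hL.norm_apply_le _).trans ih

/-- Averagedness along the orbit of `h` telescopes, so the squared displacements are summable. -/
theorem AveragedLinear.tendsto_pow_sub (hL : AveragedLinear L) (h : E) :
    Tendsto (fun n => (L ^ n) (h - L h)) atTop (𝓝 0) := by
  have hsum : ∀ n, ∑ k ∈ Finset.range n, 1 / 2 * ‖(L ^ k) (h - L h)‖ ^ 2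
      ≤ ‖h‖ ^ 2 - ‖(L ^ n) h‖ ^ 2 := by
    intro n
    induction n with
    | zero => simp
    | succ n ih =>
      rw [Finset.sum_range_succ]
      have h1 := hL ((L ^ n) h)
      have h2 : (L ^ n) (h - L h) = (L ^ n) h - L ((L ^ n) h) := by
        rw [map_sub, ← mul_apply_eq_comp, ← mul_apply_eq_comp, ← pow_succ,
          ← pow_succ']
      rw [h2, pow_succ' L, mul_apply_eq_comp]
      linarith
  have hs : Summable fun n => 1 / 2 * ‖(L ^ n) (h - L h)‖ ^ 2 :=
    summable_of_sum_range_le (c := ‖h‖ ^ 2) (fun n => by positivity)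
      fun n => (hsum n).trans (by linarith [sq_nonneg ‖(L ^ n) h‖])
  have h0 := (hs.tendsto_atTop_zero.const_mul 2).sqrt
  rw [tendsto_zero_iff_norm_tendsto_zero]
  simpa [Real.sqrt_sq (norm_nonneg _)] using h0

theorem AveragedLinear.tendsto_pow_of_mem_closure (hL : AveragedLinear L) {h : E}
    (hh : h ∈ closure (range fun y => y - L y)) : Tendsto (fun n => (L ^ n) h) atTop (𝓝 0) := by
  rw [Metric.tendsto_atTop]
  intro ε hε
  obtain ⟨_, ⟨y, rfl⟩, hy⟩ := Metric.mem_closure_iff.1 hh (ε / 2) (half_pos hε)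
  obtain ⟨N, hN⟩ := Metric.tendsto_atTop.1 (hL.tendsto_pow_sub y) (ε / 2) (half_pos hε)
  refine ⟨N, fun n hn => ?_⟩
  have h1 := hN n hn
  have h2 := hL.norm_pow_apply_le n (h - (y - L y))
  rw [dist_zero_right] at h1 ⊢
  rw [dist_eq_norm] at hy
  rw [map_sub] at h2
  linarith [norm_le_norm_add_norm_sub' ((L ^ n) h) ((L ^ n) (y - L y))]

/-- Orthogonality gives `⟪k, L k⟫ = ‖k‖ ^ 2`, whence `‖k - L k‖ ^ 2 = ‖L k‖ ^ 2 - ‖k‖ ^ 2 ≤ 0`. -/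
theorem AveragedLinear.apply_eq_of_inner_eq_zero (hL : AveragedLinear L) {k : E}
    (hk : ∀ h, ⟪k, h - L h⟫_ℝ = 0) : L k = k := by
  have h1 := hk k
  have h2 := norm_sub_sq_real k (L k)
  have h3 := hL.norm_apply_le k
  rw [inner_sub_right, real_inner_self_eq_norm_sq] at h1
  have h4 : ‖k - L k‖ ^ 2 ≤ 0 := by nlinarith [norm_nonneg (L k)]
  have h5 : k - L k = 0 := norm_eq_zero.1 (pow_eq_zero_iff two_ne_zero |>.1
    (le_antisymm h4 (sq_nonneg _)))
  exact (sub_eq_zero.1 h5).symm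

/-- In the nonexpansiveness of `L` at `t • k + h` the quadratic terms in `t` cancel; an affine
function of `t` bounded below has zero slope. -/
theorem AveragedLinear.inner_eq_zero_of_apply_eq (hL : AveragedLinear L) {k : E} (hk : L k = k)
    (h : E) : ⟪k, h - L h⟫_ℝ = 0 := by
  set d := h - L h with hd
  have key : ∀ t : ℝ, 0 ≤ 2 * t * ⟪k, d⟫_ℝ + (‖h‖ ^ 2 - ‖L h‖ ^ 2) := by
    intro t
    have h1 := hL.norm_apply_le (t • k + h)
    have h2 : ‖L (t • k + h)‖ ^ 2 ≤ ‖t • k + h‖ ^ 2 := by gcongr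
    rw [map_add, map_smul, hk, norm_add_sq_real, norm_add_sq_real, inner_smul_left,
      inner_smul_left] at h2
    rw [hd, inner_sub_right]
    simp only [conj_trivial] at h2
    linarith
  by_contra hne
  -- This `t` makes the expression equal to `-1`.
  have := key (-(‖h‖ ^ 2 - ‖L h‖ ^ 2 + 1) / (2 * ⟪k, d⟫_ℝ))
  have h3 : 2 * (-(‖h‖ ^ 2 - ‖L h‖ ^ 2 + 1) / (2 * ⟪k, d⟫_ℝ)) * ⟪k, d⟫_ℝ
      = -(‖h‖ ^ 2 - ‖L h‖ ^ 2 + 1) := by field_simp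
  linarith

theorem AveragedLinear.exists_decomposition [CompleteSpace E] (hL : AveragedLinear L) (h : E) :
    ∃ k r, h = k + r ∧ L k = k ∧ r ∈ closure (range fun y => y - L y) := by
  set R : Submodule ℝ E := (LinearMap.range ((1 - L : E →L[ℝ] E) : E →ₗ[ℝ] E)).topologicalClosure
  have hRc : (R : Set E) = closure (range fun y => y - L y) := by
    rw [Submodule.topologicalClosure_coe]; rfl
  have : CompleteSpace R := (Submodule.isClosed_topologicalClosure _).completeSpace_coe
  refine ⟨h - R.starProjection h, R.starProjection h, by abel, ?_, ?_⟩
  · refine hL.apply_eq_of_inner_eq_zero fun y => ?_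
    refine Submodule.inner_left_of_mem_orthogonal (K := R) ?_
      (R.sub_starProjection_mem_orthogonal h)
    exact Submodule.le_topologicalClosure _ ⟨y, rfl⟩
  · rw [← hRc]; exact R.starProjection_apply_mem h

/-- `Id - L` is injective on its own range, since a fixed point in `ran (Id - L)` is orthogonal to
itself. In finite dimension it is therefore bounded below there, and averagedness becomes a strict
contraction. -/
theorem AveragedLinear.exists_rate [FiniteDimensional ℝ E] (hL : AveragedLinear L) :
    ∃ μ : ℝ, 0 < μ ∧ μ < 1 ∧ ∀ r ∈ closure (range fun y => y - L y), ∀ n,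
      ‖(L ^ n) r‖ ≤ ‖r‖ * μ ^ n := by
  set D : E →ₗ[ℝ] E := ((1 - L : E →L[ℝ] E) : E →ₗ[ℝ] E) with hD
  have hDapp : ∀ y, D y = y - L y := fun y => rfl
  set R := LinearMap.range D with hR
  have hcl : closure (range fun y => y - L y) = (R : Set E) :=
    (Submodule.closed_of_finiteDimensional R).closure_eq
  have hinj : LinearMap.ker (D.domRestrict R) = ⊥ := by
    rw [LinearMap.ker_eq_bot']
    rintro ⟨r, y, rfl⟩ h0
    have h1 : L (D y) = D y := (sub_eq_zero.1 h0).symm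
    have h2 := hL.inner_eq_zero_of_apply_eq h1 y
    exact Subtype.ext (inner_self_eq_zero.1 h2)
  obtain ⟨c, hc, hanti⟩ := (D.domRestrict R).exists_antilipschitzWith hinj
  have hlow : ∀ r ∈ R, ‖r‖ ≤ (c + 1) * ‖r - L r‖ := by
    intro r hr
    have h1 := hanti.le_mul_dist (⟨r, hr⟩ : R) 0
    rw [map_zero, dist_zero_right, dist_zero_right] at h1
    have h2 : ‖r‖ ≤ c * ‖r - L r‖ := h1
    linarith [norm_nonneg (r - L r)]
  -- Using `c + 1 ≥ 1` in place of `c` ensures `e < 1`, so the rate is positive.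
  set e : ℝ := 1 / (2 * (c + 1) ^ 2) with he
  have hc1 : (1 : ℝ) ≤ c + 1 := by linarith [c.coe_nonneg]
  have he0 : 0 < e := by positivity
  have he1 : e < 1 := by
    rw [he, div_lt_one (by positivity)]; nlinarith
  have hstep : ∀ r ∈ R, ‖L r‖ ≤ √(1 - e) * ‖r‖ := by
    intro r hr
    have h1 := hlow r hr
    have h2 : ‖r‖ ^ 2 ≤ (c + 1) ^ 2 * ‖r - L r‖ ^ 2 := by rw [← mul_pow]; gcongr
    have h3 : e * ‖r‖ ^ 2 ≤ 1 / 2 * ‖r - L r‖ ^ 2 := by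
      rw [he, div_mul_eq_mul_div, div_le_iff₀ (by positivity)]; linarith
    rw [← Real.sqrt_sq (norm_nonneg r), ← Real.sqrt_mul (by linarith)]
    refine Real.le_sqrt_of_sq_le ?_
    linarith [hL r]
  refine ⟨√(1 - e), Real.sqrt_pos.2 (by linarith), ?_, ?_⟩
  · rw [Real.sqrt_lt' one_pos]; linarith
  · intro r hr n
    rw [hcl] at hr
    have hinv : ∀ n, (L ^ n) r ∈ R := by
      intro n
      obtain ⟨y, rfl⟩ := hr
      refine ⟨(L ^ n) y, ?_⟩
      rw [hDapp, hDapp, map_sub, ← mul_apply_eq_comp, ← mul_apply_eq_comp,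
        ← pow_succ, ← pow_succ']
    induction n with
    | zero => simp
    | succ n ih =>
      rw [pow_succ', mul_apply_eq_comp]
      refine (hstep _ (hinv n)).trans ?_
      rw [pow_succ']
      nlinarith [mul_le_mul_of_nonneg_left ih (Real.sqrt_nonneg (1 - e))]

end LinearIterates

/-! ### Affine operators, the minimal displacement vector and the limit of the iterates -/

section AffineIterates

variable {E : Type*} [NormedAddCommGroup E] [InnerProductSpace ℝ E]

omit [InnerProductSpace ℝ E] in
theorem isNearest_minDisp {T : E → E} (h : minDisp T ∈ ranDisp T) :
    IsNearest (closure (ranDisp T)) 0 (minDisp T) := by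
  rw [minDisp, metricProj] at h ⊢
  split_ifs at h ⊢ with hex
  · exact hex.choose_spec
  -- Here `metricProj` takes its default value `0`, which lies in the range by `h` and is then
  -- trivially nearest to `0`.
  · exact ⟨subset_closure h, fun c _ => by simp⟩

omit [InnerProductSpace ℝ E] in
theorem minDisp_eq_zero_iff {T : E → E} (h : minDisp T ∈ ranDisp T) :
    minDisp T = 0 ↔ (0 : E) ∈ ranDisp T := by
  refine ⟨fun h0 => h0 ▸ h, fun h0 => ?_⟩
  simpa using (isNearest_minDisp h).2 0 (subset_closure h0)

/-- `T` is affine with linear part `L`. -/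
def AffineWithLinear (T : E → E) (L : E →L[ℝ] E) : Prop :=
  ∀ y h, T (y + h) = T y + L h

variable {T : E → E} {L : E →L[ℝ] E}

theorem exists_averagedLinear_of_affine (hT : IsAffineOp T)
    (hav : ∀ x y, ‖T x - T y‖ ^ 2 + 1 / 2 * ‖(x - T x) - (y - T y)‖ ^ 2 ≤ ‖x - y‖ ^ 2) :
    ∃ L : E →L[ℝ] E, AveragedLinear L ∧ AffineWithLinear T L := by
  obtain ⟨F, hF⟩ := hT
  have hadd : ∀ y h, T (y + h) = T y + F.linear h := by
    intro y h
    rw [← hF, ← hF, add_comm y h, add_comm (F y)]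
    exact F.map_vadd y h
  have hL : ∀ h, ‖F.linear h‖ ^ 2 + 1 / 2 * ‖h - F.linear h‖ ^ 2 ≤ ‖h‖ ^ 2 := by
    intro h
    have := hav (0 + h) 0
    rwa [hadd, add_sub_cancel_left, sub_zero, zero_add,
      show h - (T 0 + F.linear h) - (0 - T 0) = h - F.linear h by abel] at this
  refine ⟨F.linear.mkContinuous 1 fun h => ?_, hL, hadd⟩
  rw [one_mul]
  exact pow_le_pow_iff_left₀ (norm_nonneg _) (norm_nonneg _) two_ne_zero |>.1
    (by nlinarith [hL h, sq_nonneg ‖h - F.linear h‖])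

theorem convex_ranDisp_of_affine (hT : IsAffineOp T) : Convex ℝ (ranDisp T) := by
  obtain ⟨F, hF⟩ := hT
  have : ranDisp T = (AffineMap.id ℝ E - F) '' univ := by
    rw [image_univ, ranDisp]; congr 1; funext y; simp [hF]
  rw [this]
  exact convex_univ.affine_image _

theorem isClosed_ranDisp_of_affine [FiniteDimensional ℝ E] (hT : IsAffineOp T) :
    IsClosed (ranDisp T) := by
  obtain ⟨F, hF⟩ := hT
  have : ranDisp T = ((⊤ : AffineSubspace ℝ E).map (AffineMap.id ℝ E - F) : Set E) := by
    rw [AffineSubspace.coe_map, AffineSubspace.top_coe, image_univ, ranDisp]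
    congr 1; funext y; simp [hF]
  rw [this]
  exact AffineSubspace.closed_of_finiteDimensional _

/-- Moving from `y` to `y ± h` changes the displacement by `±(h - L h)`, so the variational
inequality for the nearest point makes `v` orthogonal to `ran (Id - L)`. -/
theorem linear_minDisp (hT : IsAffineOp T) (hL : AveragedLinear L) (hTL : AffineWithLinear T L)
    {v : E} (hv : IsNearest (closure (ranDisp T)) 0 v) (hmem : v ∈ ranDisp T) : L v = v := by
  obtain ⟨y, rfl⟩ := hmem
  have hin := (nearest_iff_inner (convex_ranDisp_of_affine hT).closure hv.1).1 hv
  have hle : ∀ h, 0 ≤ ⟪y - T y, h - L h⟫_ℝ := by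
    intro h
    have h1 := hin ((y + h) - T (y + h)) (subset_closure ⟨y + h, rfl⟩)
    have h2 : (y + h) - T (y + h) - (y - T y) = h - L h := by rw [hTL]; abel
    simp only [h2, zero_sub, inner_neg_left] at h1
    linarith
  refine hL.apply_eq_of_inner_eq_zero fun h => le_antisymm ?_ (hle h)
  have h1 := hle (-h)
  rw [map_neg, ← neg_sub', inner_neg_right] at h1
  linarith

theorem iterate_add_of_linear_eq (hTL : AffineWithLinear T L) {v : E} (hv : L v = v) (x : E)
    (n : ℕ) : (fun y => v + T y)^[n] x = T^[n] x + n • v := by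
  have hs : ∀ n : ℕ, ∀ y, T (y + n • v) = T y + n • v := fun n y => by
    rw [hTL, map_nsmul, hv]
  induction n with
  | zero => simp
  | succ n ih =>
    rw [Function.iterate_succ_apply', Function.iterate_succ_apply', ih, hs, succ_nsmul]
    abel

theorem iterate_add_eq (hTL : AffineWithLinear T L) {v y₀ : E} (hy₀ : v + T y₀ = y₀) (h : E)
    (n : ℕ) : (fun y => v + T y)^[n] (y₀ + h) = y₀ + (L ^ n) h := by
  induction n with
  | zero => simp
  | succ n ih =>
    rw [Function.iterate_succ_apply', ih, hTL, pow_succ', mul_apply_eq_comp,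
      ← add_assoc, hy₀]

theorem mem_fixedPoints_add_iff (hTL : AffineWithLinear T L) {v y₀ : E} (hy₀ : v + T y₀ = y₀)
    (h : E) : y₀ + h ∈ Function.fixedPoints (fun y => v + T y) ↔ L h = h := by
  rw [Function.mem_fixedPoints, Function.IsFixedPt, hTL, ← add_assoc, hy₀, add_right_inj]

theorem isNonemptyClosedConvex_fixedPoints (hTL : AffineWithLinear T L) {v : E}
    (hv : v ∈ ranDisp T) :
    IsNonemptyClosedConvex (Function.fixedPoints (fun y => v + T y)) := by
  obtain ⟨y₀, rfl⟩ := hv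
  have hy₀ : (y₀ - T y₀) + T y₀ = y₀ := sub_add_cancel _ _
  have heq : Function.fixedPoints (fun y => (y₀ - T y₀) + T y)
      = (fun y => y - y₀) ⁻¹' {h | L h = h} := by
    ext y
    have := mem_fixedPoints_add_iff hTL hy₀ (y - y₀)
    rwa [add_sub_cancel] at this
  refine ⟨⟨y₀, hy₀⟩, ?_, ?_⟩
  · rw [heq]
    exact (isClosed_eq L.continuous continuous_id).preimage (by fun_prop)
  · rw [heq]
    intro a ha b hb s t _ _ hst
    simp only [mem_preimage, mem_ofPred_eq] at ha hb ⊢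
    have : s • a + t • b - y₀ = s • (a - y₀) + t • (b - y₀) := by
      nth_rewrite 1 [← one_smul ℝ y₀, ← hst]
      module
    rw [this, map_add, map_smul, map_smul, ha, hb]

/-- Around a fixed point `y₀`, the set of fixed points is `y₀ + Fix L`. Splitting `x - y₀ = k + r`
with `k ∈ Fix L` and `r` orthogonal to it identifies `y₀ + k` as the projection of `x`; only `r` is
moved by the iteration. -/
theorem exists_limit_decomposition [CompleteSpace E] (hL : AveragedLinear L)
    (hTL : AffineWithLinear T L) {v : E} (hv : v ∈ ranDisp T) (x : E) :
    ∃ r ∈ closure (range fun y => y - L y), ∀ n, (fun y => v + T y)^[n] x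
      = metricProj (Function.fixedPoints (fun y => v + T y)) x + (L ^ n) r := by
  have hconv := (isNonemptyClosedConvex_fixedPoints hTL hv).2.2
  obtain ⟨y₀, rfl⟩ := hv
  set v := y₀ - T y₀ with hvdef
  have hy₀ : v + T y₀ = y₀ := sub_add_cancel _ _
  obtain ⟨k, r, hkr, hk, hr⟩ := hL.exists_decomposition (x - y₀)
  have hpf : y₀ + k ∈ Function.fixedPoints (fun y => v + T y) :=
    (mem_fixedPoints_add_iff hTL hy₀ k).2 hk
  have hx : x = (y₀ + k) + r := by rw [add_assoc, ← hkr]; abel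
  have hproj : metricProj (Function.fixedPoints (fun y => v + T y)) x = y₀ + k := by
    refine metricProj_eq hconv ((nearest_iff_inner hconv hpf).2 fun c hc => ?_)
    have hc' : L (c - y₀) = c - y₀ := (mem_fixedPoints_add_iff hTL hy₀ _).1 (by simpa using hc)
    have hck : L (c - (y₀ + k)) = c - (y₀ + k) := by rw [← sub_sub, map_sub, hc', hk]
    rw [hx, add_sub_cancel_left, real_inner_comm]
    refine le_of_eq ?_
    have hsub : closure (range fun y => y - L y) ⊆ {r | ⟪c - (y₀ + k), r⟫_ℝ = 0} := by
      refine closure_minimal ?_ (isClosed_eq (by fun_prop) continuous_const)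
      rintro _ ⟨y, rfl⟩
      exact hL.inner_eq_zero_of_apply_eq hck y
    exact hsub hr
  refine ⟨r, hr, fun n => ?_⟩
  rw [hproj]
  nth_rewrite 1 [hx]
  exact iterate_add_eq hTL hpf r n

end AffineIterates

/-! ### Consequences for the projected step -/

section Splitting

variable {E : Type*} [NormedAddCommGroup E] [InnerProductSpace ℝ E]
  (K : Submodule ℝ E) [K.HasOrthogonalProjection] {A : E → E}

variable {K} in
theorem FirmlyNonexpansive.lipschitzWith_projStep (hA : FirmlyNonexpansive A) :
    LipschitzWith 1 (projStep K A) := by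
  refine LipschitzWith.of_dist_le_mul fun x y => ?_
  rw [NNReal.coe_one, one_mul, dist_eq_norm, dist_eq_norm]
  refine pow_le_pow_iff_left₀ (norm_nonneg _) (norm_nonneg _) two_ne_zero |>.1 ?_
  linarith [hA.projStep_averaged (K := K) x y,
    sq_nonneg ‖(x - projStep K A x) - (y - projStep K A y)‖]

variable {K} in
theorem FirmlyNonexpansive.nearlyEqual_ranDisp_projStep [FiniteDimensional ℝ E]
    (hA : FirmlyNonexpansive A) :
    NearlyEqual (ranDisp (projStep K A)) ((Kᗮ : Set E) + range A) :=
  nearlyEqual_ranDisp hA.lipschitzWith_projStep (ranDisp_projStep_subset K A)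
    fun _ hz => hA.exists_le_inner_sub_projStep hz

theorem isAffineOp_projStep (hA : IsAffineOp A) : IsAffineOp (projStep K A) := by
  obtain ⟨F, hF⟩ := hA
  refine ⟨K.starProjection.toLinearMap.toAffineMap.comp (AffineMap.id ℝ E - F), fun x => ?_⟩
  simp [projStep, hF]

end Splitting

/-! ### The diagonal and the product operator -/

section ProductSpace

variable {X : Type*} [NormedAddCommGroup X] [InnerProductSpace ℝ X] {m : ℕ}

/-- Closedness provides the orthogonal projection onto the diagonal when `X` is complete. -/
theorem isClosed_diagonal (m : ℕ) (X : Type*) [NormedAddCommGroup X] [InnerProductSpace ℝ X] :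
    IsClosed (diagonal m X : Set (ProdSpace m X)) := by
  have : (diagonal m X : Set (ProdSpace m X)) = {x | ∀ i j, x i = x j} := by
    ext x
    constructor
    · rintro ⟨z, hz⟩ i j
      rw [hz, hz]
    · intro h
      rcases isEmpty_or_nonempty (Fin m) with hm | ⟨⟨i⟩⟩
      · exact ⟨0, fun i => hm.elim i⟩
      · exact ⟨x i, fun j => h j i⟩
  rw [this]
  simp only [ofPred_forall]
  exact isClosed_iInter fun i => isClosed_iInter fun j => isClosed_eq (by fun_prop) (by fun_prop)

theorem mem_diagonal_orthogonal_iff {u : ProdSpace m X} : u ∈ (diagonal m X)ᗮ ↔ ∑ i, u i = 0 := by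
  rw [Submodule.mem_orthogonal']
  have key : ∀ z : X, ⟪u, (WithLp.toLp 2 fun _ => z : ProdSpace m X)⟫_ℝ = ⟪∑ i, u i, z⟫_ℝ :=
    fun z => by rw [PiLp.inner_apply, sum_inner]
  constructor
  · intro h
    refine inner_self_eq_zero (𝕜 := ℝ).1 ?_
    rw [← key]
    exact h _ ⟨_, fun i => rfl⟩
  · rintro h x ⟨z, hz⟩
    have : x = WithLp.toLp 2 fun _ => z := by ext i; exact hz i
    rw [this, key, h, inner_zero_left]

theorem firmlyNonexpansive_scaledProdOp {α : ℝ} {A : Fin m → X → X}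
    (hA : ∀ i, Cocoercive α (A i)) : FirmlyNonexpansive (scaledProdOp α A) := by
  intro x y
  simp only [PiLp.norm_sq_eq_of_L2, ← Finset.sum_add_distrib]
  exact Finset.sum_le_sum fun i _ => hA i (x i) (y i)

theorem isAffineOp_scaledProdOp (α : ℝ) {A : Fin m → X → X} (hA : ∀ i, IsAffineOp (A i)) :
    IsAffineOp (scaledProdOp α A) := by
  choose F hF using hA
  refine ⟨(WithLp.linearEquiv 2 ℝ (Fin m → X)).symm.toLinearMap.toAffineMap.comp
    (AffineMap.pi fun i => (α • F i).comp
      ((LinearMap.proj i).toAffineMap.comp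
        (WithLp.linearEquiv 2 ℝ (Fin m → X)).toLinearMap.toAffineMap)), fun x => ?_⟩
  ext i
  simp [scaledProdOp, hF]

theorem range_scaledProdOp (α : ℝ) (A : Fin m → X → X) :
    range (scaledProdOp α A) = α • prodSet (fun i => range (A i)) := by
  ext u
  rw [mem_smul_set]
  constructor
  · rintro ⟨x, rfl⟩
    exact ⟨WithLp.toLp 2 fun i => A i (x i), fun i => ⟨x i, rfl⟩, rfl⟩
  · rintro ⟨w, hw, rfl⟩
    choose y hy using hw
    refine ⟨WithLp.toLp 2 y, ?_⟩
    ext i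
    simp [scaledProdOp, hy]

end ProductSpace

end FBSplit

/-! ### The main theorem -/

theorem mainTheorem10 {X : Type*} [NormedAddCommGroup X] [InnerProductSpace ℝ X] [CompleteSpace X]
    (m : ℕ) (hm : 2 ≤ m) (a : Fin m → ℝ) (ha : ∀ i, 0 < a i)
    (A : Fin m → X → X) (hA : ∀ i, FBSplit.Cocoercive (a i) (A i))
    (α : ℝ) (hα : IsLeast (Set.range a) α)
    (Δ : Submodule ℝ (FBSplit.ProdSpace m X)) (hΔ : Δ = FBSplit.diagonal m X)
    (T : FBSplit.ProdSpace m X → FBSplit.ProdSpace m X) (hT : T = FBSplit.parallelFB α A)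
    (v : FBSplit.ProdSpace m X) (hv : v = FBSplit.minDisp T) (hv_mem : v ∈ FBSplit.ranDisp T)
    (Zv : Set (FBSplit.ProdSpace m X)) (hZv : Zv = FBSplit.normalSolutions α A)
    (x : FBSplit.ProdSpace m X) :
    ((Δᗮ : Set (FBSplit.ProdSpace m X)) = {u | ∑ i, u i = 0}) ∧
    (Zv = (v +ᵥ (Δ : Set (FBSplit.ProdSpace m X))) ∩
      FBSplit.scaledProdOp α A ⁻¹' (v +ᵥ (Δᗮ : Set (FBSplit.ProdSpace m X)))) ∧
    (v = 0 ↔ {z : X | ∑ i, A i z = 0}.Nonempty) ∧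
    (FiniteDimensional ℝ X →
      FBSplit.NearlyEqual (FBSplit.ranDisp T)
        ((Δᗮ : Set (FBSplit.ProdSpace m X)) +
          α • FBSplit.prodSet (fun i => Set.range (A i)))) ∧
    ((∀ i, FBSplit.IsAffineOp (A i)) →
      (∀ n : ℕ, (fun y => v + T y)^[n] x = (FBSplit.innerShift T (-v))^[n] x ∧
        (FBSplit.innerShift T (-v))^[n] x = T^[n] x + n • v) ∧
      FBSplit.IsNonemptyClosedConvex (Function.fixedPoints (fun y => v + T y)) ∧
      FBSplit.IsNonemptyClosedConvex Zv ∧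
      Tendsto (fun n : ℕ => T^[n] x + n • v) atTop
        (𝓝 (FBSplit.metricProj (Function.fixedPoints (fun y => v + T y)) x)) ∧
      FBSplit.metricProj (Function.fixedPoints (fun y => v + T y)) x
        = FBSplit.metricProj Zv x ∧
      (FiniteDimensional ℝ X →
        FBSplit.ConvergesLinearly (fun n : ℕ => (fun y => v + T y)^[n] x)
          (FBSplit.metricProj Zv x)) ∧
      (FiniteDimensional ℝ X →
        FBSplit.ranDisp T = (Δᗮ : Set (FBSplit.ProdSpace m X)) +
          α • FBSplit.prodSet (fun i => Set.range (A i)))) := by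
  subst hΔ hv hZv
  have : CompleteSpace (FBSplit.diagonal m X) :=
    (FBSplit.isClosed_diagonal m X).completeSpace_coe
  set K := FBSplit.diagonal m X with hK
  set B := FBSplit.scaledProdOp α A with hB
  have hTK : T = FBSplit.projStep K B := hT.trans (FBSplit.forwardBackward_normalCone K B)
  set v := FBSplit.minDisp T with hv
  have hZ : FBSplit.normalSolutions α A
      = FBSplit.perturbedZeros B (FBSplit.normalCone (K : Set _)) v := by
    rw [FBSplit.normalSolutions, ← hT]
  have hZfix : FBSplit.normalSolutions α A = Function.fixedPoints (fun y => v + T y) := by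
    rw [hZ, hTK]; exact FBSplit.perturbedZeros_eq_fixedPoints K B v
  obtain ⟨i₀, hi₀⟩ := hα.1
  have hαpos : 0 < α := hi₀ ▸ ha i₀
  -- Cocoercivity passes to smaller positive constants, so the minimum `α` serves every `A i`.
  have hBfirm : FBSplit.FirmlyNonexpansive B :=
    FBSplit.firmlyNonexpansive_scaledProdOp fun i => (hA i).anti hαpos (hα.2 ⟨i, rfl⟩)
  have hnear : FiniteDimensional ℝ X → FBSplit.NearlyEqual (FBSplit.ranDisp T)
      ((Kᗮ : Set (FBSplit.ProdSpace m X)) + α • FBSplit.prodSet (fun i => Set.range (A i))) := by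
    intro hfin
    rw [hTK, ← FBSplit.range_scaledProdOp]
    exact hBfirm.nearlyEqual_ranDisp_projStep
  refine ⟨?_, ?_, ?_, hnear, fun haff => ?_⟩
  · ext u
    exact FBSplit.mem_diagonal_orthogonal_iff
  · ext z
    rw [hZ, FBSplit.mem_perturbedZeros_iff, mem_inter_iff, mem_preimage, mem_vadd_set_iff_neg_vadd_mem,
      mem_vadd_set_iff_neg_vadd_mem, vadd_eq_add, vadd_eq_add, neg_add_eq_sub, neg_add_eq_sub]
    rfl
  · rw [FBSplit.minDisp_eq_zero_iff hv_mem, hTK, FBSplit.mem_ranDisp_zero_iff]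
    have hsum : ∀ y : FBSplit.ProdSpace m X, B y ∈ Kᗮ ↔ ∑ i, A i (y i) = 0 := by
      intro y
      rw [FBSplit.mem_diagonal_orthogonal_iff]
      simp only [hB, FBSplit.scaledProdOp]
      rw [← Finset.smul_sum, smul_eq_zero_iff_right hαpos.ne']
    constructor
    · rintro ⟨y, ⟨z, hz⟩, h⟩
      refine ⟨z, ?_⟩
      rw [hsum] at h
      simp only [hz] at h
      exact h
    · rintro ⟨z, hz⟩
      exact ⟨WithLp.toLp 2 fun _ => z, ⟨z, fun i => rfl⟩, (hsum _).2 hz⟩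
  have hTaff : FBSplit.IsAffineOp T :=
    hTK ▸ FBSplit.isAffineOp_projStep K (FBSplit.isAffineOp_scaledProdOp α haff)
  obtain ⟨L, hL, hTL⟩ := FBSplit.exists_averagedLinear_of_affine hTaff
    (hTK ▸ hBfirm.projStep_averaged)
  have hLv := FBSplit.linear_minDisp hTaff hL hTL (FBSplit.isNearest_minDisp hv_mem) hv_mem
  have hiter : ∀ n : ℕ, (fun y => v + T y)^[n] x = T^[n] x + n • v :=
    FBSplit.iterate_add_of_linear_eq hTL hLv x
  have hshift : FBSplit.innerShift T (-v) = fun y => v + T y := by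
    funext y
    rw [FBSplit.innerShift, sub_neg_eq_add, hTL, hLv, add_comm]
  obtain ⟨r, hr, hlim⟩ := FBSplit.exists_limit_decomposition hL hTL hv_mem x
  have hfix := FBSplit.isNonemptyClosedConvex_fixedPoints hTL hv_mem
  rw [hZfix, hshift]
  refine ⟨fun n => ⟨rfl, hiter n⟩, hfix, hfix, ?_, rfl, fun hfin => ?_, fun hfin => ?_⟩
  · have h := (hL.tendsto_pow_of_mem_closure hr).const_add
      (FBSplit.metricProj (Function.fixedPoints fun y => v + T y) x)
    rw [add_zero] at h
    exact h.congr fun n => (hlim n).symm.trans (hiter n)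
  · obtain ⟨μ, hμ0, hμ1, hrate⟩ := hL.exists_rate
    refine ⟨μ, hμ0, hμ1, ‖r‖, fun n => ?_⟩
    beta_reduce
    rw [hlim, add_sub_cancel_left]
    exact hrate r hr n
  · refine Subset.antisymm ?_ ?_
    · rw [hTK, ← FBSplit.range_scaledProdOp]
      exact FBSplit.ranDisp_projStep_subset K B
    -- The two sets have the same closure, and the range of an affine displacement map is already
    -- closed in finite dimension.
    · refine subset_closure.trans ((hnear hfin).1.symm.subset.trans ?_)
      exact (FBSplit.isClosed_ranDisp_of_affine hTaff).closure_eq.subset
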